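/- Formulas are built from variables $x_0,x_1,\dots$ and $\bot$ with $\wedge,\vee,\to$ and the unary operators $\square$ and $K$; put $\neg\varphi:=\varphi\to\bot$, $\varphi\leftrightarrow\psi:=(\varphi\to\psi)\wedge(\psi\to\varphi)$, $\varphi\equiv\psi:=\square(\varphi\leftrightarrow\psi)$ and $\square\Phi:=\{\square\psi\mid\psi\in\Phi\}$. Let $Fm$ be the set of all formulas, $Fm_e$ the set of formulas without $\square$, $Fm_1$ the set of formulas without $K$, and $Fm_0=Fm_e\cap Fm_1$. IPC is intuitionistic propositional logic in $Fm_0$. Let (INT) consist of all theorems of IPC and their substitution-instances. Consider the schemes - (A1) $\square(\varphi\vee\psi)\to(\square\varphi\vee\square\psi)$, (A2) $\square\varphi\to\varphi$, (A3) $\square(\varphi\to\psi)\to\square(\square\varphi\to\square\psi)$, (A4) $\square\varphi\to\square\square\varphi$, (A5) $\neg\square\varphi\to\square\neg\square\varphi$, - (Tr) $\square(\varphi\to\psi)\to(\square(\psi\to\chi)\to\square(\varphi\to\chi))$, - (KBel) $K(\varphi\to\psi)\to(K\varphi\to K\psi)$, (IntCo) $\varphi\to K\varphi$, (IntRe) $K\varphi\to\neg\neg\varphi$,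 - (TND) $\varphi\vee\neg\varphi$, (SP) $(\varphi\equiv\psi)\to(\chi[x:=\varphi]\equiv\chi[x:=\psi])$. $IEL$, in the language $Fm_e$, has the axioms (INT), (KBel), (IntCo), (IntRe) and the rule Modus Ponens. The following three systems have the rules Modus Ponens and Axiom Necessitation (from an axiom $\psi$ infer $\square\psi$), the latter applying to axioms only and not to the additional theorem schemes. $L$, in the language $Fm_1$, has the axioms (INT), (A1), (A2), (Tr) and the additional theorem schemes (TND), (SP). $L5$, in the language $Fm_1$, has the axioms (INT), (A1)--(A5) and the additional theorem scheme (TND). $EL5^*$, in the language $Fm$, has the axioms (INT), (A1)--(A5), (IntCo), (IntRe), (KBel) and the additional theorem scheme (TND). For each system, $\Phi\vdash\varphi$ means that there is a finite derivation of $\varphi$ from $\Phi$. **Theorem.** 1. For every set $\Phi\cup\{\varphi\}\subseteq Fm_e$: $$\Phi\vdash_{IEL}\varphi\iff\square\Phi\vdash_{EL5^*}\square\varphi.$$ 2. In particular, $EL5^*$ contains a copy of $IEL$: the map $\varphi\mapsto\square\varphi$ is a bijection from the set of theorems $\varphi\in Fm_e$ of $IEL$ onto the set of those theorems of $EL5^*$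 which have the form $\square\varphi$ with $\varphi\in Fm_e$. 3. This embedding extends the embedding $\varphi\mapsto\square\varphi$ of IPC into $L5$ and into $L$: for every set $\Phi\cup\{\varphi\}\subseteq Fm_0$, the conditions $\Phi\vdash_{IPC}\varphi$, $\square\Phi\vdash_{L5}\square\varphi$, $\square\Phi\vdash_{L}\square\varphi$, $\Phi\vdash_{IEL}\varphi$ and $\square\Phi\vdash_{EL5^*}\square\varphi$ are equivalent. -/

import Mathlib

namespace EpistemicLogic

/-- The full object language `Fm` over the variables `x₀, x₁, …`, with `⊥`, `∧`, `∨`, `→`,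
the modal operator `□` and the epistemic operator `K`. -/
inductive Fm : Type
  | var : ℕ → Fm
  | bot : Fm
  | and : Fm → Fm → Fm
  | or : Fm → Fm → Fm
  | imp : Fm → Fm → Fm
  | box : Fm → Fm
  | K : Fm → Fm

namespace Fm

/-- `¬φ := φ → ⊥`. -/
def neg (φ : Fm) : Fm := φ.imp bot

/-- `φ ↔ ψ := (φ → ψ) ∧ (ψ → φ)`. -/
def biimp (φ ψ : Fm) : Fm := (φ.imp ψ).and (ψ.imp φ)

/-- Propositional identity, defined as strict equivalence: `φ ≡ ψ := □(φ ↔ ψ)`. -/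
def ident (φ ψ : Fm) : Fm := (φ.biimp ψ).box

/-- Uniform (simultaneous) substitution of formulas for variables. -/
def subst (σ : ℕ → Fm) : Fm → Fm
  | var n => σ n
  | bot => bot
  | and φ ψ => (φ.subst σ).and (ψ.subst σ)
  | or φ ψ => (φ.subst σ).or (ψ.subst σ)
  | imp φ ψ => (φ.subst σ).imp (ψ.subst σ)
  | box φ => (φ.subst σ).box
  | K φ => (φ.subst σ).K

/-- `χ[x := φ]`. -/
def substVar (χ : Fm) (x : ℕ) (φ : Fm) : Fm := χ.subst (Function.update var x φ)

/-- The symbol `□` does not occur in the formula. -/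
def BoxFree : Fm → Prop
  | var _ => True
  | bot => True
  | and φ ψ => φ.BoxFree ∧ ψ.BoxFree
  | or φ ψ => φ.BoxFree ∧ ψ.BoxFree
  | imp φ ψ => φ.BoxFree ∧ ψ.BoxFree
  | box _ => False
  | K φ => φ.BoxFree

/-- The symbol `K` does not occur in the formula. -/
def KFree : Fm → Prop
  | var _ => True
  | bot => True
  | and φ ψ => φ.KFree ∧ ψ.KFree
  | or φ ψ => φ.KFree ∧ ψ.KFree
  | imp φ ψ => φ.KFree ∧ ψ.KFree
  | box φ => φ.KFree
  | K _ => False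

end Fm

/-- The pure epistemic language `Fm_e`: formulas without `□`. -/
def FmE : Set Fm := {φ | φ.BoxFree}

/-- The modal language `Fm₁`: formulas without `K`. -/
def Fm1 : Set Fm := {φ | φ.KFree}

/-- The propositional language `Fm₀`: formulas with neither `□` nor `K`. -/
def Fm0 : Set Fm := {φ | φ.BoxFree ∧ φ.KFree}

/-- `Derives S Φ φ`: there is a finite derivation of `φ` in which every formula belongs to `S`
(the formulas that may be written down outright), or belongs to `Φ`, or results from two earlier
formulas by Modus Ponens. -/
inductive Derives (S Φ : Set Fm) : Fm → Prop
  | base {φ : Fm} : φ ∈ S → Derives S Φ φ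
  | hyp {φ : Fm} : φ ∈ Φ → Derives S Φ φ
  | mp {φ ψ : Fm} : Derives S Φ (φ.imp ψ) → Derives S Φ φ → Derives S Φ ψ

/-- The axiom schemes of a standard Hilbert calculus for intuitionistic propositional logic. -/
inductive IpcScheme : Fm → Prop
  | imp_k (φ ψ : Fm) : IpcScheme (φ.imp (ψ.imp φ))
  | imp_s (φ ψ χ : Fm) :
      IpcScheme ((φ.imp (ψ.imp χ)).imp ((φ.imp ψ).imp (φ.imp χ)))
  | and_left (φ ψ : Fm) : IpcScheme ((φ.and ψ).imp φ)
  | and_right (φ ψ : Fm) : IpcScheme ((φ.and ψ).imp ψ)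
  | and_intro (φ ψ : Fm) : IpcScheme (φ.imp (ψ.imp (φ.and ψ)))
  | or_left (φ ψ : Fm) : IpcScheme (φ.imp (φ.or ψ))
  | or_right (φ ψ : Fm) : IpcScheme (ψ.imp (φ.or ψ))
  | or_elim (φ ψ χ : Fm) :
      IpcScheme ((φ.imp χ).imp ((ψ.imp χ).imp ((φ.or ψ).imp χ)))
  | bot_elim (φ : Fm) : IpcScheme (Fm.bot.imp φ)

/-- `Φ ⊢_IPC φ`, in the propositional language `Fm₀`. -/
def IPC (Φ : Set Fm) (φ : Fm) : Prop := Derives ({ψ | IpcScheme ψ} ∩ Fm0) Φ φ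

/-- (INT): all theorems of IPC and their substitution-instances. -/
def axINT : Set Fm := {χ | ∃ φ ∈ Fm0, IPC ∅ φ ∧ ∃ σ : ℕ → Fm, χ = φ.subst σ}

/-- (A1): `□(φ ∨ ψ) → (□φ ∨ □ψ)`. -/
def axA1 : Set Fm := {χ | ∃ φ ψ : Fm, χ = (φ.or ψ).box.imp (φ.box.or ψ.box)}

/-- (A2): `□φ → φ`. -/
def axA2 : Set Fm := {χ | ∃ φ : Fm, χ = φ.box.imp φ}

/-- (A3): `□(φ → ψ) → □(□φ → □ψ)`. -/
def axA3 : Set Fm := {χ | ∃ φ ψ : Fm, χ = (φ.imp ψ).box.imp (φ.box.imp ψ.box).box}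

/-- (A4): `□φ → □□φ`. -/
def axA4 : Set Fm := {χ | ∃ φ : Fm, χ = φ.box.imp φ.box.box}

/-- (A5): `¬□φ → □¬□φ`. -/
def axA5 : Set Fm := {χ | ∃ φ : Fm, χ = φ.box.neg.imp φ.box.neg.box}

/-- Transitivity of strict implication: `□(φ → ψ) → (□(ψ → θ) → □(φ → θ))`. -/
def axTrans : Set Fm :=
  {χ | ∃ φ ψ θ : Fm, χ = (φ.imp ψ).box.imp ((ψ.imp θ).box.imp (φ.imp θ).box)}

/-- (KBel): `K(φ → ψ) → (Kφ → Kψ)`. -/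
def axKBel : Set Fm := {χ | ∃ φ ψ : Fm, χ = (φ.imp ψ).K.imp (φ.K.imp ψ.K)}

/-- (IntCo), intuitionistic co-reflection: `φ → Kφ`. -/
def axIntCo : Set Fm := {χ | ∃ φ : Fm, χ = φ.imp φ.K}

/-- (IntRe), intuitionistic reflection: `Kφ → ¬¬φ`. -/
def axIntRe : Set Fm := {χ | ∃ φ : Fm, χ = φ.K.imp φ.neg.neg}

/-- (TND), tertium non datur: `φ ∨ ¬φ`. -/
def schTND : Set Fm := {χ | ∃ φ : Fm, χ = φ.or φ.neg}

/-- (SP), the Substitution Principle: `(φ ≡ ψ) → (θ[x := φ] ≡ θ[x := ψ])`. -/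
def schSP : Set Fm :=
  {χ | ∃ (φ ψ θ : Fm) (x : ℕ),
    χ = (φ.ident ψ).imp ((θ.substVar x φ).ident (θ.substVar x ψ))}

/-- `□Φ := {□ψ | ψ ∈ Φ}`. -/
def boxSet (Φ : Set Fm) : Set Fm := Fm.box '' Φ

/-- Derivability in the classical modal system with set of axioms `Ax` and additional theorem
schemes `Th`. The rules are Modus Ponens and Axiom Necessitation (from an axiom `ψ` infer `□ψ`);
the latter applies to the elements of `Ax` only, not to those of `Th`. -/
def ModalDerives (Ax Th Φ : Set Fm) (φ : Fm) : Prop := Derives (Ax ∪ boxSet Ax ∪ Th) Φ φ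

/-- The logic `IEL`, in the language `Fm_e`; the only rule is Modus Ponens. -/
def IEL (Φ : Set Fm) (φ : Fm) : Prop :=
  Derives ((axINT ∪ axKBel ∪ axIntCo ∪ axIntRe) ∩ FmE) Φ φ

/-- The logic `L`, in the language `Fm₁`. -/
def L (Φ : Set Fm) (φ : Fm) : Prop :=
  ModalDerives ((axINT ∪ axA1 ∪ axA2 ∪ axTrans) ∩ Fm1) ((schTND ∪ schSP) ∩ Fm1) Φ φ

/-- The axiom schemes of `L5`, read in the full language `Fm`. -/
def axiomsL5 : Set Fm := axINT ∪ axA1 ∪ axA2 ∪ axA3 ∪ axA4 ∪ axA5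

/-- The logic `L5`, in the language `Fm₁`. -/
def L5 (Φ : Set Fm) (φ : Fm) : Prop :=
  ModalDerives (axiomsL5 ∩ Fm1) (schTND ∩ Fm1) Φ φ

/-- The logic `EL5* = L5 + (IntCo) + (IntRe) + (KBel)`, in the full language `Fm`. -/
def EL5Star (Φ : Set Fm) (φ : Fm) : Prop :=
  ModalDerives (axiomsL5 ∪ axIntCo ∪ axIntRe ∪ axKBel) schTND Φ φ

end EpistemicLogic

open EpistemicLogic

namespace EpistemicLogic

/-! From left to right, `□` distributes over Modus Ponens: by (A3) and (A2) in `L5` and `EL5Star`,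
and in `L` by (Tr) with `⊤`, since (SP) identifies `α` with `⊤ → α`.

For the converse, suppose `IEL` does not derive `φ` from `Φ`. Zorn's lemma gives a prime theory `T ⊇
Φ` not proving `φ`, and then a maximal consistent `U ⊇ T`. Interpret `□ψ` as `⊤` or `⊥` according to
whether `T` proves the interpretation of `ψ`. Axioms and (SP) become theorems of `T`
(`prov_interp_of_mem_axioms`, `prov_interp_of_mem_schSP`), so boxed axioms become `⊤`; (TND) holds
in `U`. A derivation of `□φ` would thus make `U` prove `⊥` (`prov_of_modalDerives_box`). Erasing `K`
reduces `IEL` to IPC on `Fm0` (`Prov.ipc`). -/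

/-! ### Transport of derivations -/

theorem Derives.mono {S S' Φ Φ' : Set Fm} {φ : Fm} (hS : S ⊆ S') (hΦ : Φ ⊆ Φ')
    (h : Derives S Φ φ) : Derives S' Φ' φ := by
  induction h with
  | base h => exact .base (hS h)
  | hyp h => exact .hyp (hΦ h)
  | mp _ _ ih₁ ih₂ => exact ih₁.mp ih₂

/-- Derivations stay inside any set of formulas that contains the axioms and the hypotheses and
is closed under passing from an implication to its conclusion. -/
theorem Derives.mem_of_subset {S Φ F : Set Fm} {φ : Fm} (hS : S ⊆ F) (hΦ : Φ ⊆ F)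
    (hF : ∀ α β : Fm, α.imp β ∈ F → β ∈ F) (h : Derives S Φ φ) : φ ∈ F := by
  induction h with
  | base h => exact hS h
  | hyp h => exact hΦ h
  | mp _ _ ih₁ _ => exact hF _ _ ih₁

/-- A map that commutes with `→` and turns axioms into theorems transports derivations. -/
theorem Derives.map {S S' Φ Φ' : Set Fm} {φ : Fm} (g : Fm → Fm)
    (hg : ∀ α β : Fm, g (α.imp β) = (g α).imp (g β))
    (hS : ∀ α ∈ S, Derives S' Φ' (g α)) (hΦ : ∀ α ∈ Φ, Derives S' Φ' (g α))
    (h : Derives S Φ φ) : Derives S' Φ' (g φ) := by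
  induction h with
  | base h => exact hS _ h
  | hyp h => exact hΦ _ h
  | mp _ _ ih₁ ih₂ => exact (hg _ _ ▸ ih₁).mp ih₂

/-- If the boxed axioms of `S` are theorems and `□` distributes over implications of `F`, then
`φ ↦ □φ` transports derivations inside `F`. -/
theorem Derives.box {S S' Φ F : Set Fm} {φ : Fm} (hS : S ⊆ F) (hΦ : Φ ⊆ F)
    (hF : ∀ α β : Fm, α.imp β ∈ F → β ∈ F)
    (hbox : ∀ α ∈ S, Derives S' (boxSet Φ) α.box)
    (hdist : ∀ α β : Fm, α.imp β ∈ F → Derives S' (boxSet Φ) (α.imp β).box →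
      Derives S' (boxSet Φ) α.box → Derives S' (boxSet Φ) β.box)
    (h : Derives S Φ φ) : Derives S' (boxSet Φ) φ.box := by
  induction h with
  | base h => exact hbox _ h
  | hyp h => exact .hyp ⟨_, h, rfl⟩
  | mp h₁ _ ih₁ ih₂ => exact hdist _ _ (h₁.mem_of_subset hS hΦ hF) ih₁ ih₂

/-! ### Intuitionistic propositional logic -/

theorem Fm.subst_mem_Fm0 {φ : Fm} (hφ : φ ∈ Fm0) {σ : ℕ → Fm} (hσ : ∀ n, σ n ∈ Fm0) :
    φ.subst σ ∈ Fm0 := by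
  induction φ with
  | var n => exact hσ n
  | bot => exact hφ
  | box => exact hφ.1.elim
  | K => exact hφ.2.elim
  | _ => simp_all [Fm.subst, Fm0, Fm.BoxFree, Fm.KFree]

theorem IpcScheme.subst {φ : Fm} (h : IpcScheme φ) (σ : ℕ → Fm) : IpcScheme (φ.subst σ) := by
  cases h <;> constructor

theorem IPC.subst {φ : Fm} (h : IPC ∅ φ) {σ : ℕ → Fm} (hσ : ∀ n, σ n ∈ Fm0) :
    IPC ∅ (φ.subst σ) :=
  Derives.map (Fm.subst σ) (fun _ _ => rfl)
    (fun _ hα => .base ⟨hα.1.subst σ, Fm.subst_mem_Fm0 hα.2 hσ⟩) (fun _ hα => hα.elim) h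

theorem IPC.imp_self {Φ : Set Fm} {α : Fm} (h : α ∈ Fm0) : IPC Φ (α.imp α) :=
  Derives.mp (.mp
    (.base ⟨.imp_s α (α.imp α) α, by simp [Fm.BoxFree, h.1], by simp [Fm.KFree, h.2]⟩)
    (.base ⟨.imp_k _ _, by simp [Fm.BoxFree, h.1], by simp [Fm.KFree, h.2]⟩))
    (.base ⟨.imp_k _ _, by simp [Fm.BoxFree, h.1], by simp [Fm.KFree, h.2]⟩)

theorem IPC.double_neg_intro {Φ : Set Fm} {α : Fm} (h : α ∈ Fm0) : IPC Φ (α.imp α.neg.neg) := by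
  have hs {β : Fm} (hβ : IpcScheme β) (h0 : β ∈ Fm0) : IPC Φ β := .base ⟨hβ, h0⟩
  obtain ⟨hb, hk⟩ := h
  have h₁ : IPC Φ ((α.neg.imp α).imp α.neg.neg) :=
    (hs (.imp_s α.neg α .bot) (by simp [Fm0, Fm.neg, Fm.BoxFree, Fm.KFree, hb, hk])).mp
      (IPC.imp_self (by simp [Fm0, Fm.neg, Fm.BoxFree, Fm.KFree, hb, hk]))
  have h₂ : IPC Φ (α.imp ((α.neg.imp α).imp α.neg.neg)) :=
    (hs (.imp_k _ _) (by simp [Fm0, Fm.neg, Fm.BoxFree, Fm.KFree, hb, hk])).mp h₁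
  exact ((hs (.imp_s _ _ _) (by simp [Fm0, Fm.neg, Fm.BoxFree, Fm.KFree, hb, hk])).mp h₂).mp
    (hs (.imp_k _ _) (by simp [Fm0, Fm.neg, Fm.BoxFree, Fm.KFree, hb, hk]))

/-- Every instance of a scheme is a substitution instance of its scheme written with three variables. -/
theorem IpcScheme.mem_axINT {φ : Fm} (h : IpcScheme φ) : φ ∈ axINT := by
  have key (α β γ : Fm) (θ : Fm) (hθ : IpcScheme θ) (h0 : θ ∈ Fm0)
      (e : φ = θ.subst (fun | 0 => α | 1 => β | _ => γ)) : φ ∈ axINT :=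
    ⟨θ, h0, .base ⟨hθ, h0⟩, _, e⟩
  cases h with
  | imp_k α β =>
    exact key α β α _ (.imp_k (.var 0) (.var 1)) (by simp [Fm0, Fm.BoxFree, Fm.KFree]) rfl
  | imp_s α β γ =>
    exact key α β γ _ (.imp_s (.var 0) (.var 1) (.var 2)) (by simp [Fm0, Fm.BoxFree, Fm.KFree]) rfl
  | and_left α β =>
    exact key α β α _ (.and_left (.var 0) (.var 1)) (by simp [Fm0, Fm.BoxFree, Fm.KFree]) rfl
  | and_right α β =>
    exact key α β α _ (.and_right (.var 0) (.var 1)) (by simp [Fm0, Fm.BoxFree, Fm.KFree]) rfl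
  | and_intro α β =>
    exact key α β α _ (.and_intro (.var 0) (.var 1)) (by simp [Fm0, Fm.BoxFree, Fm.KFree]) rfl
  | or_left α β =>
    exact key α β α _ (.or_left (.var 0) (.var 1)) (by simp [Fm0, Fm.BoxFree, Fm.KFree]) rfl
  | or_right α β =>
    exact key α β α _ (.or_right (.var 0) (.var 1)) (by simp [Fm0, Fm.BoxFree, Fm.KFree]) rfl
  | or_elim α β γ =>
    exact key α β γ _ (.or_elim (.var 0) (.var 1) (.var 2)) (by simp [Fm0, Fm.BoxFree, Fm.KFree]) rfl
  | bot_elim α =>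
    exact key α α α _ (.bot_elim (.var 0)) (by simp [Fm0, Fm.BoxFree, Fm.KFree]) rfl

/-- `⊤ := ⊥ → ⊥`. -/
def Fm.top : Fm := Fm.bot.imp Fm.bot

/-- Being an axiom, it may be boxed, which yields the identity `φ ≡ (⊤ → φ)` needed to apply (SP) in
`L`. -/
theorem biimp_top_imp_mem_axINT (φ : Fm) : φ.biimp (Fm.top.imp φ) ∈ axINT := by
  have hv {ψ : Fm} (h : IpcScheme ψ) (h0 : ψ ∈ Fm0) : IPC ∅ ψ := .base ⟨h, h0⟩
  have hT : IPC ∅ Fm.top := hv (.bot_elim _) (by simp [Fm.top, Fm0, Fm.BoxFree, Fm.KFree])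
  let A : Fm := Fm.top.imp (.var 0)
  have hAA : IPC ∅ (A.imp A) := IPC.imp_self (by simp [A, Fm.top, Fm0, Fm.BoxFree, Fm.KFree])
  have hAT : IPC ∅ (A.imp Fm.top) :=
    (hv (.imp_k Fm.top A) (by simp [A, Fm.top, Fm0, Fm.BoxFree, Fm.KFree])).mp hT
  have hAx : IPC ∅ (A.imp (.var 0)) :=
    ((hv (.imp_s A Fm.top (.var 0)) (by simp [A, Fm.top, Fm0, Fm.BoxFree, Fm.KFree])).mp hAA).mp hAT
  have hxA : IPC ∅ ((Fm.var 0).imp A) :=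
    hv (.imp_k _ _) (by simp [A, Fm.top, Fm0, Fm.BoxFree, Fm.KFree])
  refine ⟨(Fm.var 0).biimp A, by simp [A, Fm.top, Fm.biimp, Fm0, Fm.BoxFree, Fm.KFree], ?_,
    fun _ => φ, rfl⟩
  exact ((hv (.and_intro _ _) (by simp [A, Fm.top, Fm0, Fm.BoxFree, Fm.KFree])).mp hxA).mp hAx

/-! ### Translations that change only the meaning of `□` and `K` -/

/-- The homomorphic map that replaces `□` and `K` by the operations `b` and `k`. -/
def translate (b k : Fm → Fm) : Fm → Fm
  | .var n => .var n
  | .bot => .bot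
  | .and φ ψ => (translate b k φ).and (translate b k ψ)
  | .or φ ψ => (translate b k φ).or (translate b k ψ)
  | .imp φ ψ => (translate b k φ).imp (translate b k ψ)
  | .box φ => b (translate b k φ)
  | .K φ => k (translate b k φ)

/-- A pattern without `□` and `K` is untouched by the translation, which therefore moves into the
substitution. Hence (INT) is stable under every choice of `b` and `k`. -/
theorem translate_subst (b k : Fm → Fm) {φ : Fm} (hφ : φ ∈ Fm0) (σ : ℕ → Fm) :
    translate b k (φ.subst σ) = φ.subst (fun n => translate b k (σ n)) := by
  induction φ with
  | box => exact hφ.1.elim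
  | K => exact hφ.2.elim
  | _ => simp_all [Fm.subst, translate, Fm0, Fm.BoxFree, Fm.KFree]

theorem translate_mem_axINT (b k : Fm → Fm) {φ : Fm} (h : φ ∈ axINT) :
    translate b k φ ∈ axINT := by
  obtain ⟨θ, hθ, hd, σ, rfl⟩ := h
  exact ⟨θ, hθ, hd, _, translate_subst b k hθ σ⟩

theorem translate_of_mem_FmE (b : Fm → Fm) {φ : Fm} (h : φ ∈ FmE) :
    translate b Fm.K φ = φ := by
  induction φ with
  | box => exact h.elim
  | _ => simp_all [translate, FmE, Fm.BoxFree]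

theorem translate_of_mem_Fm0 (b k : Fm → Fm) {φ : Fm} (h : φ ∈ Fm0) : translate b k φ = φ := by
  induction φ with
  | box => exact h.1.elim
  | K => exact h.2.elim
  | _ => simp_all [translate, Fm0, Fm.BoxFree, Fm.KFree]

theorem translate_id_K_mem_FmE (φ : Fm) : translate id Fm.K φ ∈ FmE := by
  induction φ <;> simp_all [translate, FmE, Fm.BoxFree]

theorem translate_id_id_mem_Fm0 (φ : Fm) : translate id id φ ∈ Fm0 := by
  induction φ <;> simp_all [translate, Fm0, Fm.BoxFree, Fm.KFree]

/-! ### Intuitionistic epistemic logic in the full language -/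

/-- The axioms of `IEL`, read in the full language; `□` is then an uninterpreted symbol. -/
def axiomsIEL : Set Fm := axINT ∪ axKBel ∪ axIntCo ∪ axIntRe

theorem axINT_subset_axiomsIEL : axINT ⊆ axiomsIEL := fun _ h => .inl (.inl (.inl h))

/-- `IEL` in the full language. -/
abbrev Prov (Γ : Set Fm) (φ : Fm) : Prop := Derives axiomsIEL Γ φ

namespace Prov

variable {Γ : Set Fm} {α β γ δ : Fm}

theorem scheme (h : IpcScheme α) : Prov Γ α := .base (axINT_subset_axiomsIEL h.mem_axINT)

theorem imp_intro (h : Prov Γ β) : Prov Γ (α.imp β) := (scheme (.imp_k β α)).mp h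

theorem imp_self : Prov Γ (α.imp α) :=
  ((scheme (.imp_s α (α.imp α) α)).mp (scheme (.imp_k _ _))).mp (scheme (.imp_k _ _))

theorem deduction (h : Prov (insert α Γ) β) : Prov Γ (α.imp β) := by
  induction h with
  | base h => exact imp_intro (.base h)
  | hyp h =>
    obtain rfl | h := h
    · exact imp_self
    · exact imp_intro (.hyp h)
  | mp _ _ ih₁ ih₂ => exact ((scheme (.imp_s _ _ _)).mp ih₁).mp ih₂

theorem weaken (h : Prov Γ β) : Prov (insert α Γ) β := h.mono subset_rfl (Set.subset_insert _ _)

theorem assumption : Prov (insert α Γ) α := .hyp (Set.mem_insert _ _)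

theorem ex_falso (h : Prov Γ .bot) : Prov Γ α := (scheme (.bot_elim α)).mp h

theorem and_intro (h₁ : Prov Γ α) (h₂ : Prov Γ β) : Prov Γ (α.and β) :=
  ((scheme (.and_intro _ _)).mp h₁).mp h₂

theorem and_left (h : Prov Γ (α.and β)) : Prov Γ α := (scheme (.and_left _ _)).mp h

theorem and_right (h : Prov Γ (α.and β)) : Prov Γ β := (scheme (.and_right _ _)).mp h

theorem or_left (h : Prov Γ α) : Prov Γ (α.or β) := (scheme (.or_left _ _)).mp h

theorem or_right (h : Prov Γ β) : Prov Γ (α.or β) := (scheme (.or_right _ _)).mp h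

theorem or_elim (h₁ : Prov Γ (α.imp γ)) (h₂ : Prov Γ (β.imp γ)) : Prov Γ ((α.or β).imp γ) :=
  ((scheme (.or_elim _ _ _)).mp h₁).mp h₂

theorem trans (h₁ : Prov Γ (α.imp β)) (h₂ : Prov Γ (β.imp γ)) : Prov Γ (α.imp γ) :=
  deduction (h₂.weaken.mp (h₁.weaken.mp assumption))

theorem and_mono (h₁ : Prov Γ (α.imp β)) (h₂ : Prov Γ (γ.imp δ)) :
    Prov Γ ((α.and γ).imp (β.and δ)) :=
  deduction (and_intro (h₁.weaken.mp (and_left assumption))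
    (h₂.weaken.mp (and_right assumption)))

theorem or_mono (h₁ : Prov Γ (α.imp β)) (h₂ : Prov Γ (γ.imp δ)) :
    Prov Γ ((α.or γ).imp (β.or δ)) :=
  or_elim (h₁.trans (scheme (.or_left _ _))) (h₂.trans (scheme (.or_right _ _)))

theorem imp_mono (h₁ : Prov Γ (β.imp α)) (h₂ : Prov Γ (γ.imp δ)) :
    Prov Γ ((α.imp γ).imp (β.imp δ)) :=
  deduction ((h₁.weaken.trans assumption).trans h₂.weaken)

/-- Co-reflection serves as necessitation for `K`, even under hypotheses; (KBel) then distributes.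
-/
theorem K_mono (h : Prov Γ (α.imp β)) : Prov Γ (α.K.imp β.K) :=
  (Derives.base (.inl (.inl (.inr ⟨α, β, rfl⟩)))).mp
    ((Derives.base (.inl (.inr ⟨_, rfl⟩))).mp h)

/-- Derivations are finite, so a chain's union avoids `φ` when its members do: the hypothesis of
Zorn's lemma. -/
theorem exists_of_sUnion {c : Set (Set Fm)} (hc : IsChain (· ⊆ ·) c) (hne : c.Nonempty)
    (h : Prov (⋃₀ c) α) : ∃ s ∈ c, Prov s α := by
  induction h with
  | base h => exact hne.imp fun s hs => ⟨hs, .base h⟩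
  | hyp h =>
    obtain ⟨s, hs, h⟩ := h
    exact ⟨s, hs, .hyp h⟩
  | mp _ _ ih₁ ih₂ =>
    obtain ⟨s, hs, h₁⟩ := ih₁
    obtain ⟨t, ht, h₂⟩ := ih₂
    obtain hst | hts := hc.total hs ht
    · exact ⟨t, ht, (h₁.mono subset_rfl hst).mp h₂⟩
    · exact ⟨s, hs, h₁.mp (h₂.mono subset_rfl hts)⟩

end Prov

/-! ### Maximal avoiding sets and primeness -/

/-- `M` is maximal among the sets from which `φ` is not derivable. -/
structure IsMaximalAvoiding (M : Set Fm) (φ : Fm) : Prop where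
  not_prov : ¬ Prov M φ
  imp_of_notMem : ∀ α, α ∉ M → Prov M (α.imp φ)

theorem exists_isMaximalAvoiding {Γ : Set Fm} {φ : Fm} (h : ¬ Prov Γ φ) :
    ∃ M, Γ ⊆ M ∧ IsMaximalAvoiding M φ := by
  obtain ⟨M, hΓM, hM⟩ := zorn_subset_nonempty {M | ¬ Prov M φ}
    (fun c hcs hc hne => ⟨⋃₀ c, fun hd =>
      let ⟨s, hs, hsd⟩ := hd.exists_of_sUnion hc hne
      hcs hs hsd, fun _ => Set.subset_sUnion_of_mem⟩) Γ h
  refine ⟨M, hΓM, hM.prop, fun α hα => Prov.deduction ?_⟩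
  by_contra hd
  exact hα (hM.le_of_ge hd (Set.subset_insert α M) (Set.mem_insert α M))

namespace IsMaximalAvoiding

variable {M : Set Fm} {φ α β : Fm}

theorem prime (hM : IsMaximalAvoiding M φ) (h : Prov M (α.or β)) : Prov M α ∨ Prov M β := by
  by_contra! hn
  exact hM.not_prov ((Prov.or_elim (hM.imp_of_notMem α fun h => hn.1 (.hyp h))
    (hM.imp_of_notMem β fun h => hn.2 (.hyp h))).mp h)

theorem or_neg (hM : IsMaximalAvoiding M .bot) (α : Fm) : Prov M (α.or α.neg) := by
  by_cases h : α ∈ M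
  · exact Prov.or_left (.hyp h)
  · exact Prov.or_right (hM.imp_of_notMem α h)

end IsMaximalAvoiding

/-! ### Reading `□` as membership in a prime theory -/

open Classical in
/-- `⊤` for theorems of the theory `T`, and `⊥` for all other formulas. -/
noncomputable def truthValue (T : Set Fm) (φ : Fm) : Fm := if Prov T φ then Fm.top else Fm.bot

/-- The translation that reads `□` as provability in `T`. -/
noncomputable def interp (T : Set Fm) : Fm → Fm := translate (truthValue T) Fm.K

section Interp

variable {T : Set Fm} {φ ψ : Fm}

theorem interp_imp : interp T (φ.imp ψ) = (interp T φ).imp (interp T ψ) := rfl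

theorem interp_box_of_prov (h : Prov T (interp T φ)) : interp T φ.box = Fm.top := if_pos h

theorem interp_box_of_not_prov (h : ¬ Prov T (interp T φ)) : interp T φ.box = Fm.bot := if_neg h

theorem prov_interp_box (h : Prov T (interp T φ)) : Prov T (interp T φ.box) := by
  rw [interp_box_of_prov h]
  exact Prov.imp_self

/-- An interpreted box is `⊤` or `⊥`, so an implication from it can be checked at the metalevel; in
the `⊥` case explosion proves it. -/
theorem prov_interp_box_imp (h : Prov T (interp T φ) → Prov T (interp T ψ)) :
    Prov T (interp T (φ.box.imp ψ)) := by
  rw [interp_imp]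
  by_cases hφ : Prov T (interp T φ)
  · exact Prov.imp_intro (h hφ)
  · rw [interp_box_of_not_prov hφ]
    exact Prov.scheme (.bot_elim _)

/-- Both directions go through one induction because `→` is contravariant on the left. In the `□`
case, formulas equivalent over `T` receive the same truth value. -/
theorem prov_interp_subst_imp {σ τ : ℕ → Fm}
    (h : ∀ n, Prov T ((interp T (σ n)).imp (interp T (τ n))))
    (h' : ∀ n, Prov T ((interp T (τ n)).imp (interp T (σ n)))) (θ : Fm) :
    Prov T ((interp T (θ.subst σ)).imp (interp T (θ.subst τ))) ∧
      Prov T ((interp T (θ.subst τ)).imp (interp T (θ.subst σ))) := by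
  induction θ with
  | var n => exact ⟨h n, h' n⟩
  | bot => exact ⟨Prov.imp_self, Prov.imp_self⟩
  | and _ _ ih₁ ih₂ => exact ⟨.and_mono ih₁.1 ih₂.1, .and_mono ih₁.2 ih₂.2⟩
  | or _ _ ih₁ ih₂ => exact ⟨.or_mono ih₁.1 ih₂.1, .or_mono ih₁.2 ih₂.2⟩
  | imp _ _ ih₁ ih₂ => exact ⟨.imp_mono ih₁.2 ih₂.1, .imp_mono ih₁.1 ih₂.2⟩
  | K _ ih => exact ⟨.K_mono ih.1, .K_mono ih.2⟩
  | box _ ih =>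
    exact ⟨prov_interp_box_imp fun hd => prov_interp_box (ih.1.mp hd),
      prov_interp_box_imp fun hd => prov_interp_box (ih.2.mp hd)⟩

theorem prov_interp_of_mem_schSP (h : φ ∈ schSP) : Prov T (interp T φ) := by
  obtain ⟨α, β, θ, x, rfl⟩ := h
  refine prov_interp_box_imp fun hd => prov_interp_box ?_
  have key := prov_interp_subst_imp (T := T) (σ := Function.update Fm.var x α)
    (τ := Function.update Fm.var x β) (fun n => ?_) (fun n => ?_) θ
  · exact Prov.and_intro key.1 key.2
  · obtain rfl | hn := eq_or_ne n x
    · simp only [Function.update_self]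
      exact Prov.and_left hd
    · simpa [hn] using Prov.imp_self
  · obtain rfl | hn := eq_or_ne n x
    · simp only [Function.update_self]
      exact Prov.and_right hd
    · simpa [hn] using Prov.imp_self

/-- The modal and epistemic axioms of all the systems are sound when `□` is read as provability
in a prime theory. -/
theorem prov_interp_of_mem_axioms {θ : Fm} (hT : IsMaximalAvoiding T θ)
    (h : φ ∈ axiomsL5 ∪ axIntCo ∪ axIntRe ∪ axKBel ∪ axTrans) : Prov T (interp T φ) := by
  obtain ((((((((((h | h) | h) | h) | h) | h) | h) | h) | h)) | h) := h
  · exact .base (axINT_subset_axiomsIEL (translate_mem_axINT _ _ h))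
  · obtain ⟨α, β, rfl⟩ := h
    refine prov_interp_box_imp fun hd => ?_
    -- Only (A1) needs `T` to be prime.
    obtain hd | hd := hT.prime hd
    · exact Prov.or_left (prov_interp_box hd)
    · exact Prov.or_right (prov_interp_box hd)
  · obtain ⟨α, rfl⟩ := h
    exact prov_interp_box_imp id
  · obtain ⟨α, β, rfl⟩ := h
    exact prov_interp_box_imp fun hd => prov_interp_box
      (prov_interp_box_imp fun hα => prov_interp_box (hd.mp hα))
  · obtain ⟨α, rfl⟩ := h
    exact prov_interp_box_imp fun hα => prov_interp_box (prov_interp_box hα)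
  · obtain ⟨α, rfl⟩ := h
    by_cases hα : Prov T (interp T α)
    · exact Prov.deduction (Prov.ex_falso
        (Prov.assumption.mp (prov_interp_box hα).weaken))
    · refine Prov.imp_intro (prov_interp_box ?_)
      rw [Fm.neg, interp_imp, interp_box_of_not_prov hα]
      exact Prov.imp_self
  · obtain ⟨α, rfl⟩ := h
    exact .base (.inl (.inr ⟨_, rfl⟩))
  · obtain ⟨α, rfl⟩ := h
    exact .base (.inr ⟨_, rfl⟩)
  · obtain ⟨α, β, rfl⟩ := h
    exact .base (.inl (.inl (.inr ⟨_, _, rfl⟩)))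
  · obtain ⟨α, β, γ, rfl⟩ := h
    refine prov_interp_box_imp fun h₁ => prov_interp_box_imp fun h₂ => prov_interp_box ?_
    exact Prov.trans h₁ h₂

end Interp

/-- Any modal system with the above axioms and with (TND) and (SP) proves `□φ` from `□Φ` only if
`φ` is derivable from `Φ` in `IEL`. -/
theorem prov_of_modalDerives_box {Ax Th Φ : Set Fm} {φ : Fm}
    (hAx : Ax ⊆ axiomsL5 ∪ axIntCo ∪ axIntRe ∪ axKBel ∪ axTrans) (hTh : Th ⊆ schTND ∪ schSP)
    (hΦ : Φ ⊆ FmE) (hφ : φ ∈ FmE) (h : ModalDerives Ax Th (boxSet Φ) φ.box) : Prov Φ φ := by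
  by_contra hn
  obtain ⟨T, hΦT, hT⟩ := exists_isMaximalAvoiding hn
  -- `T` need not decide every formula, so (TND) is verified in a classical extension `U`, while `□`
  -- still refers to `T`.
  obtain ⟨U, hTU, hU⟩ :=
    exists_isMaximalAvoiding (Γ := T) (φ := .bot) fun hb => hT.not_prov hb.ex_falso
  have lift {α : Fm} (hα : Prov T α) : Prov U α := hα.mono subset_rfl hTU
  have sound : Prov U (interp T φ.box) := by
    refine Derives.map (interp T) (fun _ _ => rfl) (fun α hα => ?_) (fun α hα => ?_) h
    · obtain (hα | ⟨β, hβ, rfl⟩) | hα := hα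
      · exact lift (prov_interp_of_mem_axioms hT (hAx hα))
      -- Boxing requires provability in `T` itself, not just in `U`; hence Axiom Necessitation is
      -- harmless, whereas (TND) could not be boxed this way.
      · exact lift (prov_interp_box (prov_interp_of_mem_axioms hT (hAx hβ)))
      · obtain ⟨β, rfl⟩ | hα := hTh hα
        · exact hU.or_neg _
        · exact lift (prov_interp_of_mem_schSP hα)
    · obtain ⟨β, hβ, rfl⟩ := hα
      refine lift (prov_interp_box ?_)
      rw [interp, translate_of_mem_FmE _ (hΦ hβ)]
      exact .hyp (hΦT hβ)
  rw [interp_box_of_not_prov] at sound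
  · exact hU.not_prov sound
  · rw [interp, translate_of_mem_FmE _ hφ]
    exact hT.not_prov

/-! ### Comparison of the systems -/

/-- Erasing every `□` sends axioms to axioms and fixes `Φ` and `φ`, so detours through boxed
formulas disappear. -/
theorem Prov.iel {Φ : Set Fm} {φ : Fm} (hΦ : Φ ⊆ FmE) (hφ : φ ∈ FmE) (h : Prov Φ φ) :
    IEL Φ φ := by
  rw [← translate_of_mem_FmE id hφ]
  refine Derives.map (translate id Fm.K) (fun _ _ => rfl) (fun α hα => .base ⟨?_, ?_⟩)
    (fun α hα => .hyp ?_) h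
  · obtain ((hα | ⟨β, γ, rfl⟩) | ⟨β, rfl⟩) | ⟨β, rfl⟩ := hα
    · exact .inl (.inl (.inl (translate_mem_axINT _ _ hα)))
    · exact .inl (.inl (.inr ⟨_, _, rfl⟩))
    · exact .inl (.inr ⟨_, rfl⟩)
    · exact .inr ⟨_, rfl⟩
  · exact translate_id_K_mem_FmE α
  · rwa [translate_of_mem_FmE _ (hΦ hα)]

theorem IEL.prov {Φ : Set Fm} {φ : Fm} (h : IEL Φ φ) : Prov Φ φ :=
  Derives.mono Set.inter_subset_left subset_rfl h

/-- `IEL` is conservative over IPC: delete all occurrences of `K`. -/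
theorem Prov.ipc {Φ : Set Fm} {φ : Fm} (hΦ : Φ ⊆ Fm0) (hφ : φ ∈ Fm0) (h : Prov Φ φ) :
    IPC Φ φ := by
  have hINT {α : Fm} (hα : α ∈ axINT) : IPC Φ (translate id id α) := by
    obtain ⟨θ, hθ, hd, σ, rfl⟩ := hα
    rw [translate_subst _ _ hθ]
    exact (hd.subst fun n => translate_id_id_mem_Fm0 _).mono subset_rfl (Set.empty_subset _)
  rw [← translate_of_mem_Fm0 id id hφ]
  refine Derives.map (translate id id) (fun _ _ => rfl) (fun α hα => ?_) (fun α hα => .hyp ?_) h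
  · obtain ((hα | ⟨β, γ, rfl⟩) | ⟨β, rfl⟩) | ⟨β, rfl⟩ := hα
    · exact hINT hα
    -- Without `K`, (KBel) and (IntCo) become instances of `α → α`, and (IntRe) becomes `β → ¬¬β`.
    · exact IPC.imp_self (translate_id_id_mem_Fm0 (β.imp γ))
    · exact IPC.imp_self (translate_id_id_mem_Fm0 β)
    · refine hINT (α := β.imp β.neg.neg) ⟨(Fm.var 0).imp (Fm.var 0).neg.neg,
        by simp [Fm0, Fm.neg, Fm.BoxFree, Fm.KFree], ?_, fun _ => β, rfl⟩
      exact IPC.double_neg_intro (by simp [Fm0, Fm.BoxFree, Fm.KFree])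
  · rwa [translate_of_mem_Fm0 _ _ (hΦ hα)]

theorem IPC.iel {Φ : Set Fm} {φ : Fm} (h : IPC Φ φ) : IEL Φ φ :=
  Derives.mono (fun _ hα => ⟨axINT_subset_axiomsIEL hα.1.mem_axINT, hα.2.1⟩) subset_rfl h

theorem IEL.el5Star {Φ : Set Fm} {φ : Fm} (h : IEL Φ φ) : EL5Star (boxSet Φ) φ.box := by
  refine Derives.box (Set.subset_univ _) (Set.subset_univ _) (fun _ _ _ => trivial)
    (fun α hα => .base (.inl (.inr ⟨α, ?_, rfl⟩))) (fun α β _ h₁ h₂ => ?_) h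
  · obtain ((hα | hα) | hα) | hα := hα.1
    · exact .inl (.inl (.inl (.inl (.inl (.inl (.inl (.inl hα)))))))
    · exact .inr hα
    · exact .inl (.inl (.inr hα))
    · exact .inl (.inr hα)
  -- (A3) gives `□(□α → □β)` and (A2) removes the outer box.
  · refine Derives.mp (φ := α.box) (.mp (φ := (α.box.imp β.box).box) (.base (.inl (.inl ?_)))
      (.mp (φ := (α.imp β).box) (.base (.inl (.inl ?_))) h₁)) h₂
    · exact .inl (.inl (.inl (.inl (.inl (.inl (.inr ⟨α.box.imp β.box, rfl⟩))))))
    · exact .inl (.inl (.inl (.inl (.inl (.inr ⟨α, β, rfl⟩)))))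

theorem Fm0_subset_Fm1 : Fm0 ⊆ Fm1 := fun _ h => h.2

theorem IPC.l5 {Φ : Set Fm} {φ : Fm} (hΦ : Φ ⊆ Fm0) (h : IPC Φ φ) : L5 (boxSet Φ) φ.box := by
  refine Derives.box (F := Fm1) (fun α hα => hα.2.2) (hΦ.trans Fm0_subset_Fm1)
    (fun _ _ hαβ => hαβ.2) (fun α hα => .base (.inl (.inr ⟨α, ⟨?_, hα.2.2⟩, rfl⟩)))
    (fun α β hαβ h₁ h₂ => ?_) h
  · exact .inl (.inl (.inl (.inl (.inl hα.1.mem_axINT))))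
  · refine Derives.mp (φ := α.box) (.mp (φ := (α.box.imp β.box).box)
      -- `KFree` ignores boxes, so each side of the axiom unfolds to the type of `hαβ`.
      (.base (.inl (.inl ⟨?_, hαβ, hαβ⟩)))
      (.mp (φ := (α.imp β).box) (.base (.inl (.inl ⟨?_, hαβ, hαβ⟩))) h₁)) h₂
    · exact .inl (.inl (.inl (.inr ⟨α.box.imp β.box, rfl⟩)))
    · exact .inl (.inl (.inr ⟨α, β, rfl⟩))

/-- In `L`, the formulas `□φ` and `□(⊤ → φ)` are interderivable. -/
theorem L.box_iff_box_top_imp {Γ : Set Fm} {φ : Fm} (hφ : φ ∈ Fm1) :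
    L Γ φ.box ↔ L Γ (Fm.top.imp φ).box := by
  have hφ' : φ.KFree := hφ
  have hident : L Γ (φ.ident (Fm.top.imp φ)) := .base (.inl (.inr ⟨_,
    ⟨.inl (.inl (.inl (biimp_top_imp_mem_axINT φ))),
      by simp [Fm1, Fm.biimp, Fm.top, Fm.KFree, hφ']⟩, rfl⟩))
  -- (SP) is applied in the context `□x₀`.
  have hSP : L Γ ((φ.ident (Fm.top.imp φ)).imp (φ.box.ident (Fm.top.imp φ).box)) :=
    .base (.inr ⟨.inr ⟨φ, Fm.top.imp φ, (Fm.var 0).box, 0, by simp [Fm.substVar, Fm.subst]⟩,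
      by simp [Fm1, Fm.ident, Fm.biimp, Fm.top, Fm.KFree, hφ']⟩)
  have hA2 : L Γ ((φ.box.ident (Fm.top.imp φ).box).imp (φ.box.biimp (Fm.top.imp φ).box)) :=
    .base (.inl (.inl ⟨.inl (.inr ⟨_, rfl⟩),
      by simp [Fm1, Fm.ident, Fm.biimp, Fm.top, Fm.KFree, hφ']⟩))
  have hiff := hA2.mp (hSP.mp hident)
  have hint {α : Fm} (hα : IpcScheme α) (h1 : α ∈ Fm1) : L Γ α :=
    .base (.inl (.inl ⟨.inl (.inl (.inl hα.mem_axINT)), h1⟩))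
  constructor
  · exact ((hint (.and_left _ _) (by simp [Fm1, Fm.top, Fm.KFree, hφ'])).mp hiff).mp
  · exact ((hint (.and_right _ _) (by simp [Fm1, Fm.top, Fm.KFree, hφ'])).mp hiff).mp

theorem IPC.l {Φ : Set Fm} {φ : Fm} (hΦ : Φ ⊆ Fm0) (h : IPC Φ φ) : L (boxSet Φ) φ.box := by
  refine Derives.box (F := Fm1) (fun α hα => hα.2.2) (hΦ.trans Fm0_subset_Fm1)
    (fun _ _ hαβ => hαβ.2) (fun α hα => .base (.inl (.inr ⟨α, ⟨?_, hα.2.2⟩, rfl⟩)))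
    (fun α β hαβ h₁ h₂ => ?_) h
  · exact .inl (.inl (.inl hα.1.mem_axINT))
  · obtain ⟨hα, hβ⟩ : α.KFree ∧ β.KFree := hαβ
    -- (Tr) composes `□(⊤ → α)` with `□(α → β)`, replacing the absent (A3).
    refine (L.box_iff_box_top_imp hβ).2 (Derives.mp (.mp (.base (.inl (.inl ⟨.inr
      ⟨Fm.top, α, β, rfl⟩, ?_⟩))) ((L.box_iff_box_top_imp hα).1 h₂)) h₁)
    simp [Fm1, Fm.top, Fm.KFree, hα, hβ]

theorem EL5Star.prov {Φ : Set Fm} {φ : Fm} (hΦ : Φ ⊆ FmE) (hφ : φ ∈ FmE)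
    (h : EL5Star (boxSet Φ) φ.box) : Prov Φ φ :=
  prov_of_modalDerives_box Set.subset_union_left Set.subset_union_left hΦ hφ h

theorem L.prov {Φ : Set Fm} {φ : Fm} (hΦ : Φ ⊆ FmE) (hφ : φ ∈ FmE)
    (h : L (boxSet Φ) φ.box) : Prov Φ φ := by
  refine prov_of_modalDerives_box (fun α hα => ?_) Set.inter_subset_left hΦ hφ h
  obtain ((hα | hα) | hα) | hα := hα.1
  · exact .inl (.inl (.inl (.inl (.inl (.inl (.inl (.inl (.inl hα))))))))
  · exact .inl (.inl (.inl (.inl (.inl (.inl (.inl (.inl (.inr hα))))))))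
  · exact .inl (.inl (.inl (.inl (.inl (.inl (.inl (.inr hα)))))))
  · exact .inr hα

theorem L5.el5Star {Γ : Set Fm} {φ : Fm} (h : L5 Γ φ) : EL5Star Γ φ :=
  have hAx : axiomsL5 ∩ Fm1 ⊆ axiomsL5 ∪ axIntCo ∪ axIntRe ∪ axKBel :=
    fun _ h => .inl (.inl (.inl h.1))
  Derives.mono (Set.union_subset_union (Set.union_subset_union hAx (Set.image_mono hAx))
    Set.inter_subset_left) subset_rfl h

theorem iel_iff_el5Star {Φ : Set Fm} {φ : Fm} (hΦ : Φ ⊆ FmE) (hφ : φ ∈ FmE) :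
    IEL Φ φ ↔ EL5Star (boxSet Φ) φ.box :=
  ⟨IEL.el5Star, fun h => (h.prov hΦ hφ).iel hΦ hφ⟩

end EpistemicLogic

/-- For `□`-free formulas, derivability in `IEL` is derivability in `EL5*` under `φ ↦ □φ`; the
`□`-images of the theorems of `IEL` form a faithful copy of `IEL` inside `EL5*`; and this
embedding extends the embedding `φ ↦ □φ` of IPC into `L5` and into `L`. -/
theorem theorem2000 :
    (∀ (Φ : Set Fm) (φ : Fm), Φ ⊆ FmE → φ ∈ FmE →
      (IEL Φ φ ↔ EL5Star (boxSet Φ) φ.box)) ∧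
    Set.BijOn Fm.box {φ | φ ∈ FmE ∧ IEL ∅ φ} {χ | χ ∈ boxSet FmE ∧ EL5Star ∅ χ} ∧
    (∀ (Φ : Set Fm) (φ : Fm), Φ ⊆ Fm0 → φ ∈ Fm0 →
      (IPC Φ φ ↔ L5 (boxSet Φ) φ.box) ∧
      (IPC Φ φ ↔ L (boxSet Φ) φ.box) ∧
      (IPC Φ φ ↔ IEL Φ φ) ∧
      (L5 (boxSet Φ) φ.box ↔ EL5Star (boxSet Φ) φ.box)) := by
  refine ⟨fun Φ φ hΦ hφ => iel_iff_el5Star hΦ hφ, ⟨?_, ?_, ?_⟩, fun Φ φ hΦ hφ => ?_⟩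
  · rintro φ ⟨hφ, h⟩
    have h := h.el5Star
    rw [boxSet, Set.image_empty] at h
    exact ⟨⟨φ, hφ, rfl⟩, h⟩
  · rintro φ - ψ - h
    exact Fm.box.inj h
  · rintro _ ⟨⟨φ, hφ, rfl⟩, h⟩
    refine ⟨φ, ⟨hφ, (iel_iff_el5Star (Set.empty_subset _) hφ).2 ?_⟩, rfl⟩
    rwa [boxSet, Set.image_empty]
  · have hΦE : Φ ⊆ FmE := fun α hα => (hΦ hα).1
    have hL5 : L5 (boxSet Φ) φ.box → IPC Φ φ :=
      fun h => (h.el5Star.prov hΦE hφ.1).ipc hΦ hφ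
    exact ⟨⟨fun h => h.l5 hΦ, hL5⟩,
      ⟨fun h => h.l hΦ, fun h => (h.prov hΦE hφ.1).ipc hΦ hφ⟩,
      ⟨IPC.iel, fun h => h.prov.ipc hΦ hφ⟩,
      ⟨L5.el5Star, fun h => ((h.prov hΦE hφ.1).ipc hΦ hφ).l5 hΦ⟩⟩
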